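/- Let $K$ be a field, $n\ge 1$, and $S=K[x_{ij} : 1\le i,j\le n]$. Let $I(2,n)\subset S$ be the toric ideal of the Segre embedding of $\mathbb P^{n-1}\times\mathbb P^{n-1}$, i.e. the kernel of $S\to K[r_1,\dots,r_n,s_1,\dots,s_n]$, $x_{ij}\mapsto r_is_j$. Let $H(2,n)\subset S$ be the ideal generated by the following monomials, in which only off-diagonal variables $x_{ab}$, $a\ne b$, occur: (1) the products $x_{ik}x_{hj}$ with $i=j$ or $h=k$; (2) the products $x_{ij}x_{hk}$ with $i<h$ and $j<k$. Let $\succ$ be the (graded) reverse lexicographic term order on $S$ given by any total order of the variables such that $x_{11}\prec x_{22}\prec\cdots\prec x_{nn}\prec x_{ij}$ for all $i\ne j$, and such that, for off-diagonal variables, $x_{ij}\succ x_{hk}$ whenever $|i-j|<|h-k|$. Then: (a) $I(2,n)$ is the ideal generated by the $2$-minors $x_{ij}x_{hk}-x_{ik}x_{hj}$ ($i<h$, $j<k$) of the generic $n\times n$ matrix $(x_{ij})$. (b) $\operatorname{in}_\succ(I(2,n))=H(2,n)$. (c) $H(2,n)$ is pure of dimension $2n-1$ and degree $\binom{2n-2}{n-1}$: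 $\dim S/H(2,n)=2n-1$, $\dim S/P=2n-1$ for every associated prime $P$ of $S/H(2,n)$, and the multiplicity of $S/H(2,n)$ is $\binom{2n-2}{n-1}$. (d) Let $\Delta$ be the simplicial complex whose faces are the sets of variables whose product is not in $H(2,n)$. Its cone points (the vertices contained in every facet) are exactly the $n$ variables $x_{11},\dots,x_{nn}$. The core of $\Delta$, i.e. its restriction to the vertices that are not cone points, is pure; it has exactly $\binom{2n-2}{n-1}$ facets, and each of them has dimension $n-2$ (the dimension of a face $F$ is $|F|-1$). -/

import Mathlib

open MvPolynomial

/-! ### The reverse lexicographic term order attached to an order of the variables -/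

/-- Exponent vectors `σ →₀ ℕ`, carrying the (graded) reverse lexicographic order in which the
variables are ordered by `ord`. -/
def RevLexExp (σ : Type*) (_ord : LinearOrder σ) : Type _ := σ →₀ ℕ

namespace RevLexExp

variable {σ : Type*} {ord : LinearOrder σ}

noncomputable instance : AddCommMonoid (RevLexExp σ ord) :=
  inferInstanceAs (AddCommMonoid (σ →₀ ℕ))

/-- The negative of an exponent vector, as an integral vector. -/
noncomputable def neg (a : σ →₀ ℕ) : σ →₀ ℤ :=
  -(a.mapRange (fun m : ℕ => (m : ℤ)) Nat.cast_zero)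

theorem neg_apply (a : σ →₀ ℕ) (i : σ) : neg a i = -(a i : ℤ) := by
  simp [neg]

theorem neg_add (a b : σ →₀ ℕ) : neg (a + b) = neg a + neg b := by
  ext i
  simp [neg_apply]
  ring

/-- The sort key: first the total degree, then the negated exponents compared lexicographically,
starting from the smallest variable. -/
noncomputable def key (a : RevLexExp σ ord) : ℕ ×ₗ Lex (σ →₀ ℤ) :=
  toLex (Finsupp.degree (show σ →₀ ℕ from a), toLex (neg a))

theorem key_injective : Function.Injective (key : RevLexExp σ ord → _) := by
  intro a b h
  have h2 : neg a = neg b := toLex.injective (congrArg Prod.snd (toLex.injective h))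
  refine Finsupp.ext (f := a) (g := b) fun i => ?_
  have h3 : neg (show σ →₀ ℕ from a) i = neg (show σ →₀ ℕ from b) i := DFunLike.congr_fun h2 i
  have h4 := (neg_apply (σ := σ) a i).symm.trans (h3.trans (neg_apply (σ := σ) b i))
  exact Int.ofNat_inj.1 (neg_injective h4)

noncomputable instance : LinearOrder (RevLexExp σ ord) :=
  LinearOrder.lift' key key_injective

theorem lt_iff {a b : RevLexExp σ ord} :
    a < b ↔ Finsupp.degree (show σ →₀ ℕ from a) < Finsupp.degree (show σ →₀ ℕ from b) ∨
      Finsupp.degree (show σ →₀ ℕ from a) = Finsupp.degree (show σ →₀ ℕ from b) ∧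
        toLex (neg a) < toLex (neg b) :=
  Prod.Lex.toLex_lt_toLex

theorem le_iff {a b : RevLexExp σ ord} :
    a ≤ b ↔ Finsupp.degree (show σ →₀ ℕ from a) < Finsupp.degree (show σ →₀ ℕ from b) ∨
      Finsupp.degree (show σ →₀ ℕ from a) = Finsupp.degree (show σ →₀ ℕ from b) ∧
        toLex (neg a) ≤ toLex (neg b) :=
  Prod.Lex.toLex_le_toLex

instance : IsOrderedAddMonoid (RevLexExp σ ord) where
  add_le_add_left a b h c := by
    rw [le_iff] at h ⊢
    have e : ∀ x : RevLexExp σ ord, Finsupp.degree (show σ →₀ ℕ from (x + c)) =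
        Finsupp.degree (show σ →₀ ℕ from x) + Finsupp.degree (show σ →₀ ℕ from c) :=
      fun x => map_add Finsupp.degree (show σ →₀ ℕ from x) (show σ →₀ ℕ from c)
    have f : ∀ x : RevLexExp σ ord, toLex (neg (x + c)) = toLex (neg x) + toLex (neg c) :=
      fun x => congrArg toLex (neg_add x c)
    rw [e, e, f, f]
    rcases h with h | ⟨h, h'⟩
    · exact Or.inl (by omega)
    · exact Or.inr ⟨by omega, add_le_add_left h' _⟩

theorem le_of_le {a b : σ →₀ ℕ} (h : a ≤ b) :
    (show RevLexExp σ ord from a) ≤ (show RevLexExp σ ord from b) := by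
  obtain ⟨c, rfl⟩ := exists_add_of_le h
  rw [le_iff]
  have e := map_add Finsupp.degree a c
  rcases Nat.eq_zero_or_pos (Finsupp.degree c) with hc | hc
  · have : c = 0 := (Finsupp.degree_eq_zero_iff c).1 hc
    subst this
    exact Or.inr ⟨by simp, by simp⟩
  · refine Or.inl ?_
    change Finsupp.degree a < Finsupp.degree (a + c)
    omega

instance [Finite σ] : WellFoundedLT (RevLexExp σ ord) := by
  refine ⟨RelEmbedding.wellFounded_iff_isEmpty.2 ⟨fun g => ?_⟩⟩
  obtain ⟨m, k, hmk, hle⟩ :=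
    wellQuasiOrdered_le (α := σ →₀ ℕ) (fun t => (show σ →₀ ℕ from g t))
  have h1 : g k < g m := g.map_rel_iff.2 hmk
  exact absurd (le_of_le (ord := ord) hle) (not_le_of_gt h1)

end RevLexExp

/-- The reverse lexicographic term order on the monomials in finitely many variables `σ`, where
`ord` orders the variables: `ord.lt x y` means that `y` is the larger variable. -/
noncomputable def revLexOrder {σ : Type*} [Finite σ] (ord : LinearOrder σ) : MonomialOrder σ where
  syn := RevLexExp σ ord
  toSyn := { toEquiv := Equiv.refl (σ →₀ ℕ), map_add' := fun _ _ => rfl }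
  toSyn_monotone _ _ h := RevLexExp.le_of_le h

open scoped MonomialOrder in
/-- The usual description: `x^a ≺ x^b` if `x^a` has smaller degree, or both have the same degree
and `x^a` has the larger exponent at the smallest variable at which they differ. -/
theorem revLexOrder_lt_iff {σ : Type*} [Finite σ] (ord : LinearOrder σ) (a b : σ →₀ ℕ) :
    a ≺[revLexOrder ord] b ↔ a.degree < b.degree ∨
      a.degree = b.degree ∧ ∃ v, (∀ w, ord.lt w v → a w = b w) ∧ b v < a v := by
  change (show RevLexExp σ ord from a) < (show RevLexExp σ ord from b) ↔ _
  refine (RevLexExp.lt_iff (ord := ord)).trans ?_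
  refine or_congr Iff.rfl (and_congr Iff.rfl ?_)
  rw [Finsupp.Lex.lt_iff]
  refine exists_congr fun v => and_congr (forall_congr' fun w => imp_congr Iff.rfl ?_) ?_
  · change RevLexExp.neg a w = RevLexExp.neg b w ↔ _
    rw [RevLexExp.neg_apply, RevLexExp.neg_apply]
    omega
  · change RevLexExp.neg a v < RevLexExp.neg b v ↔ _
    rw [RevLexExp.neg_apply, RevLexExp.neg_apply]
    omega

/-! ### Ideals -/

/-- The initial ideal of `I` with respect to the term order `m`. -/
noncomputable def initialIdeal {σ K : Type*} [Field K] (m : MonomialOrder σ)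
    (I : Ideal (MvPolynomial σ K)) : Ideal (MvPolynomial σ K) :=
  Ideal.span (m.leadingTerm '' (I : Set (MvPolynomial σ K)))

/-- The toric ideal of the Segre embedding of `ℙⁿ⁻¹ × ℙⁿ⁻¹`: the kernel of
`K[x_ij] → K[r_1, …, r_n, s_1, …, s_n]`, `x_ij ↦ r_i s_j`. -/
noncomputable def segreIdeal (K : Type*) [Field K] (n : ℕ) :
    Ideal (MvPolynomial (Fin n × Fin n) K) :=
  RingHom.ker (aeval (fun p : Fin n × Fin n =>
    (X (Sum.inl p.1) * X (Sum.inr p.2) : MvPolynomial (Fin n ⊕ Fin n) K)) :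
      MvPolynomial (Fin n × Fin n) K →ₐ[K] MvPolynomial (Fin n ⊕ Fin n) K)

/-- The `2`-minors of the generic `n × n` matrix `(x_ij)`. -/
def twoMinors (K : Type*) [Field K] (n : ℕ) : Set (MvPolynomial (Fin n × Fin n) K) :=
  {f | ∃ i h j k : Fin n, i < h ∧ j < k ∧ f = X (i, j) * X (h, k) - X (i, k) * X (h, j)}

/-- The monomials `x_ik x_hj` in off-diagonal variables with `i = j` or `h = k`. -/
def monomialsOne (K : Type*) [Field K] (n : ℕ) : Set (MvPolynomial (Fin n × Fin n) K) :=
  {f | ∃ i h j k : Fin n, i ≠ k ∧ h ≠ j ∧ (i = j ∨ h = k) ∧ f = X (i, k) * X (h, j)}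

/-- The monomials `x_ij x_hk` in off-diagonal variables with `i < h` and `j < k`. -/
def monomialsTwo (K : Type*) [Field K] (n : ℕ) : Set (MvPolynomial (Fin n × Fin n) K) :=
  {f | ∃ i h j k : Fin n, i ≠ j ∧ h ≠ k ∧ i < h ∧ j < k ∧ f = X (i, j) * X (h, k)}

/-- The monomial ideal `H(2,n)`. -/
noncomputable def idealH (K : Type*) [Field K] (n : ℕ) : Ideal (MvPolynomial (Fin n × Fin n) K) :=
  Ideal.span (monomialsOne K n ∪ monomialsTwo K n)

/-- The orders of the variables under consideration:
`x_11 ≺ x_22 ≺ ⋯ ≺ x_nn ≺ {x_ij : i ≠ j}`, and among the off-diagonal variables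
`x_hk ≺ x_ij` if `|i - j| < |h - k|`. -/
structure IsDiagonalOrder {n : ℕ} (ord : LinearOrder (Fin n × Fin n)) : Prop where
  diag_lt_diag : ∀ i j : Fin n, i < j → ord.lt (i, i) (j, j)
  diag_lt_offDiag : ∀ i h k : Fin n, h ≠ k → ord.lt (i, i) (h, k)
  offDiag_lt_offDiag : ∀ i j h k : Fin n, i ≠ j → h ≠ k →
    |(i : ℤ) - (j : ℤ)| < |(h : ℤ) - (k : ℤ)| → ord.lt (h, k) (i, j)

/-- The Hilbert function of `K[x] / I`, for a homogeneous ideal `I`: the dimension of the space of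
residue classes of homogeneous polynomials of degree `d`. -/
noncomputable def hilbertFn {σ K : Type*} [Field K] (I : Ideal (MvPolynomial σ K)) (d : ℕ) : ℕ :=
  Module.finrank K
    ((homogeneousSubmodule σ K d).map (Ideal.Quotient.mkₐ K I).toLinearMap)

/-- `K[x] / I` has degree (multiplicity) `e`: its Hilbert series is `h(z) / (1 - z)^D` with `h` an
integral polynomial, `D` the Krull dimension of `K[x] / I`, and `h(1) = e`. -/
def HasDegree {σ K : Type*} [Field K] (I : Ideal (MvPolynomial σ K)) (e : ℕ) : Prop :=
  ∃ (D : ℕ) (h : Polynomial ℤ), ringKrullDim (MvPolynomial σ K ⧸ I) = (D : WithBot ℕ∞) ∧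
    PowerSeries.mk (fun d => (hilbertFn I d : ℤ)) * (1 - PowerSeries.X) ^ D
      = (h : PowerSeries ℤ) ∧
    h.eval 1 = (e : ℤ)

/-- `I` is pure of dimension `D`: `K[x] / P` has dimension `D` for all associated primes `P` of
`I`, and so does `K[x] / I`. -/
def IsPureIdeal {σ K : Type*} [Field K] (I : Ideal (MvPolynomial σ K)) (D : ℕ) : Prop :=
  ringKrullDim (MvPolynomial σ K ⧸ I) = (D : WithBot ℕ∞) ∧
    ∀ P ∈ associatedPrimes (MvPolynomial σ K) (MvPolynomial σ K ⧸ I),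
      ringKrullDim (MvPolynomial σ K ⧸ P) = (D : WithBot ℕ∞)

/-! ### Simplicial complexes -/

/-- A simplicial complex with vertices in `V`. Unlike in Mathlib's
`PreAbstractSimplicialComplex`, the empty set may be a face (of dimension `-1`). -/
structure FaceComplex (V : Type*) where
  faces : Set (Finset V)
  down_closed : ∀ F ∈ faces, ∀ G ⊆ F, G ∈ faces

namespace FaceComplex

variable {V : Type*} (Δ : FaceComplex V)

/-- The facets: the inclusion-maximal faces. -/
def facets : Set (Finset V) := {F | Maximal (· ∈ Δ.faces) F}

/-- The cone points: the vertices contained in every facet. -/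
def conePoints : Set V := {v | ∀ F ∈ Δ.facets, v ∈ F}

/-- The core: the restriction to the vertices that are not cone points. -/
def core : FaceComplex V where
  faces := {F | F ∈ Δ.faces ∧ ∀ v ∈ F, v ∉ Δ.conePoints}
  down_closed F hF G hG := ⟨Δ.down_closed F hF.1 G hG, fun v hv => hF.2 v (hG hv)⟩

/-- Purity: all facets have the same dimension. -/
def IsPure : Prop := ∀ F ∈ Δ.facets, ∀ G ∈ Δ.facets, F.card = G.card

end FaceComplex

/-- The dimension of a face. -/
def faceDim {V : Type*} (F : Finset V) : ℤ := (F.card : ℤ) - 1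

/-- The simplicial complex associated with a squarefree monomial ideal `I`: its faces are the sets
of variables whose product is not in `I`. -/
def complexOf {σ K : Type*} [Field K] (I : Ideal (MvPolynomial σ K)) : FaceComplex σ where
  faces := {F | (∏ v ∈ F, (X v : MvPolynomial σ K)) ∉ I}
  down_closed _ hF _ hG hI := hF (I.mem_of_dvd (Finset.prod_dvd_prod_of_subset _ _ _ hG) hI)

/-! ### Squarefree monomial ideals -/

/-! The generators of `H(2,n)` are squarefree, so `H(2,n)` is the ideal of non-faces of
`segreComplex n`, and the monomials outside it are those supported on faces. Two facts link these
monomials to the Segre ideal.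

First, every generator is the leading term of a 2-minor up to sign: the other term contains a
variable smaller than both of its factors (`IsBadPair.ord_lt`). Rewriting therefore terminates, and
every monomial is congruent modulo the minors to one supported on a face (`exists_normalForm`).

Second, the toric map is injective on monomials supported on faces (`eq_of_segreExp_eq`): two such
monomials with the same image share a variable, which can be cancelled. Hence no leading monomial of
the toric ideal is supported on a face. This yields both the initial ideal and generation by the
minors.

Purity is combinatorial: a maximal face off the diagonal is a staircase with `n - 1` cells
(`OffDiag.card_of_maximal`), and the `n` diagonal cells can always be added. The facets are not
counted directly. Monomials on faces correspond to pairs of monomials of equal degree in `n`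
variables, which gives the Hilbert series; the value of its numerator at 1 is both the multiplicity
and the number of faces of top size. -/

/-- `I` is the monomial ideal of the non-faces of `Δ`: a polynomial lies in `I` if and only if the
supports of all its monomials are non-faces. -/
def IsNonFaceIdeal {σ K : Type*} [Field K] (Δ : FaceComplex σ)
    (I : Ideal (MvPolynomial σ K)) : Prop :=
  ∀ f, f ∈ I ↔ ∀ m ∈ f.support, m.support ∉ Δ.faces

theorem FaceComplex.exists_facet_superset {V : Type*} [Finite V] (Δ : FaceComplex V)
    {F : Finset V} (hF : F ∈ Δ.faces) : ∃ G ∈ Δ.facets, F ⊆ G := by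
  obtain ⟨G, h, hG⟩ := Δ.faces.toFinite.exists_le_maximal hF
  exact ⟨G, hG, h⟩

theorem FaceComplex.ext_faces {V : Type*} {Δ Γ : FaceComplex V} (h : Δ.faces = Γ.faces) :
    Δ = Γ := by
  cases Δ; cases Γ; cases h; rfl

namespace IsNonFaceIdeal

variable {σ K : Type*} [Field K] {Δ : FaceComplex σ} {I : Ideal (MvPolynomial σ K)}

theorem monomial_mem_iff (hI : IsNonFaceIdeal Δ I) (m : σ →₀ ℕ) :
    monomial m (1 : K) ∈ I ↔ m.support ∉ Δ.faces := by
  classical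
  rw [hI]
  simp [support_monomial]

theorem complexOf_eq (hI : IsNonFaceIdeal Δ I) : complexOf I = Δ := by
  classical
  refine FaceComplex.ext_faces (Set.ext fun F => ?_)
  change (∏ v ∈ F, (X v : MvPolynomial σ K)) ∉ I ↔ _
  have h : ∏ v ∈ F, (X v : MvPolynomial σ K) = monomial (∑ v ∈ F, Finsupp.single v 1) 1 := by
    rw [monomial_sum_one]
    rfl
  have h' : (∑ v ∈ F, Finsupp.single v 1 : σ →₀ ℕ).support = F := by
    ext w
    simp [Finsupp.finsetSum_apply, Finsupp.single_apply]
  rw [h, hI.monomial_mem_iff, h', not_not]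

end IsNonFaceIdeal

/-- The prime ideal generated by the variables outside `F`. -/
noncomputable def facePrime {σ : Type*} (K : Type*) [Field K] (F : Finset σ) :
    Ideal (MvPolynomial σ K) :=
  RingHom.ker (killCompl (R := K) (Subtype.val_injective : Function.Injective ((↑) : F → σ)))

section facePrime

variable {σ K : Type*} [Field K]

instance (F : Finset σ) : (facePrime K F).IsPrime := RingHom.ker_isPrime _

/-- Setting the variables outside `F` to zero keeps exactly the terms supported in `F`, with their
coefficients. -/
theorem mem_facePrime_iff (F : Finset σ) (f : MvPolynomial σ K) :
    f ∈ facePrime K F ↔ ∀ m ∈ f.support, ¬ m.support ⊆ F := by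
  classical
  rw [facePrime, RingHom.mem_ker]
  change killCompl _ f = 0 ↔ _
  rw [MvPolynomial.ext_iff]
  constructor
  · intro h m hm hmF
    have hr : (m.support : Set σ) ⊆ Set.range ((↑) : F → σ) := by
      intro x hx
      exact ⟨⟨x, hmF hx⟩, rfl⟩
    have h2 := h (m.comapDomain _ Subtype.val_injective.injOn)
    rw [coeff_killCompl, Finsupp.mapDomain_comapDomain _ Subtype.val_injective _ hr] at h2
    exact mem_support_iff.1 hm (by simpa using h2)
  · intro h s
    rw [coeff_killCompl, coeff_zero]
    by_contra hne
    refine h _ (mem_support_iff.2 hne) fun x hx => ?_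
    obtain ⟨y, -, rfl⟩ := Finset.mem_image.1 (Finsupp.mapDomain_support hx)
    exact y.2

theorem ringKrullDim_quotient_facePrime (F : Finset σ) :
    ringKrullDim (MvPolynomial σ K ⧸ facePrime K F) = (F.card : WithBot ℕ∞) := by
  have e := RingHom.quotientKerEquivOfSurjective
    (f := (killCompl (R := K) (Subtype.val_injective :
      Function.Injective ((↑) : F → σ))).toRingHom)
    (fun p => ⟨rename _ p, killCompl_rename_app _ p⟩)
  refine (ringKrullDim_eq_of_ringEquiv e).trans ?_
  rw [MvPolynomial.ringKrullDim_of_isNoetherianRing, ringKrullDim_eq_zero_of_field]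
  simp

end facePrime

namespace IsNonFaceIdeal

variable {σ K : Type*} [Field K] {Δ : FaceComplex σ} {I : Ideal (MvPolynomial σ K)}

/-- Since every face lies in a facet, `I` is the intersection of the primes of the facets. The
dimension and associated primes are read off from this decomposition. -/
theorem mem_iff_forall_facePrime [Finite σ] (hI : IsNonFaceIdeal Δ I) (f : MvPolynomial σ K) :
    f ∈ I ↔ ∀ F ∈ Δ.facets, f ∈ facePrime K F := by
  rw [hI]
  simp only [mem_facePrime_iff]
  constructor
  · intro h F hF m hm hmF
    exact h m hm (Δ.down_closed F hF.1 _ hmF)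
  · intro h m hm hmΔ
    obtain ⟨G, hG, hmG⟩ := Δ.exists_facet_superset hmΔ
    exact h G hG m hm hmG

theorem le_facePrime [Finite σ] (hI : IsNonFaceIdeal Δ I) {F : Finset σ} (hF : F ∈ Δ.facets) :
    I ≤ facePrime K F :=
  fun f hf => (hI.mem_iff_forall_facePrime f).1 hf F hF

theorem exists_facePrime_le [Finite σ] (hI : IsNonFaceIdeal Δ I) {P : Ideal (MvPolynomial σ K)}
    [P.IsPrime] (hP : I ≤ P) : ∃ F ∈ Δ.facets, facePrime K F ≤ P := by
  have h : Δ.facets.toFinite.toFinset.inf (facePrime K) ≤ P := by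
    refine le_trans (fun f hf => (hI.mem_iff_forall_facePrime f).2 fun F hF => ?_) hP
    rw [Submodule.mem_finsetInf] at hf
    exact hf F (by simpa using hF)
  obtain ⟨F, hF, h⟩ := (Ideal.IsPrime.inf_le' ‹_›).1 h
  exact ⟨F, by simpa using hF, h⟩

/-- Write `P = I : f`. Elements of all the face primes that avoid `f` multiply `f` into `I`, so `P`
contains one of these primes; conversely `g * f ∈ I` forces `g` into that prime. -/
theorem eq_facePrime_of_mem_associatedPrimes [Finite σ] (hI : IsNonFaceIdeal Δ I)
    {P : Ideal (MvPolynomial σ K)}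
    (hP : P ∈ associatedPrimes (MvPolynomial σ K) (MvPolynomial σ K ⧸ I)) :
    ∃ F ∈ Δ.facets, P = facePrime K F := by
  classical
  obtain ⟨hprime, x, hx⟩ := isAssociatedPrime_iff.1 (AssociatedPrimes.mem_iff.1 hP)
  obtain ⟨f, rfl⟩ := Ideal.Quotient.mk_surjective x
  have hmem : ∀ g, g ∈ P ↔ g * f ∈ I := fun g => by
    rw [hx, Submodule.mem_colon_singleton, Submodule.mem_bot, ← Ideal.Quotient.eq_zero_iff_mem,
      map_mul]
    rfl
  have h : (Δ.facets.toFinite.toFinset.filter (f ∉ facePrime K ·)).inf (facePrime K) ≤ P := by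
    intro g hg
    rw [Submodule.mem_finsetInf] at hg
    rw [hmem, hI.mem_iff_forall_facePrime]
    intro F hF
    by_cases hfF : f ∈ facePrime K F
    · exact Ideal.mul_mem_left _ _ hfF
    · exact Ideal.mul_mem_right _ _ (hg F (by simpa using ⟨hF, hfF⟩))
  obtain ⟨F, hF, hFP⟩ := (Ideal.IsPrime.inf_le' hprime).1 h
  simp only [Finset.mem_filter, Set.Finite.mem_toFinset] at hF
  refine ⟨F, hF.1, le_antisymm (fun g hg => ?_) hFP⟩
  exact (Ideal.IsPrime.mem_or_mem inferInstance
    (hI.le_facePrime hF.1 ((hmem g).1 hg))).resolve_right hF.2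

theorem ringKrullDim_quotient [Finite σ] (hI : IsNonFaceIdeal Δ I) {D : ℕ}
    (hne : Δ.facets.Nonempty) (hD : ∀ F ∈ Δ.facets, F.card = D) :
    ringKrullDim (MvPolynomial σ K ⧸ I) = (D : WithBot ℕ∞) := by
  apply le_antisymm
  · rw [_root_.ringKrullDim_quotient]
    -- The first prime of a chain above `I` contains some face prime, so the whole chain lies above
    -- that face prime.
    refine iSup_le fun l => ?_
    obtain ⟨F, hF, hle⟩ := hI.exists_facePrime_le
      (P := l.head.1.asIdeal) ((PrimeSpectrum.mem_zeroLocus _ _).1 l.head.2)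
    rw [← hD F hF, ← ringKrullDim_quotient_facePrime (K := K), _root_.ringKrullDim_quotient]
    let l' : LTSeries (PrimeSpectrum.zeroLocus (R := MvPolynomial σ K) (facePrime K F)) :=
      { length := l.length
        toFun := fun i => ⟨(l i).1, (PrimeSpectrum.mem_zeroLocus _ _).2
          (hle.trans (LTSeries.head_le l i))⟩
        step := fun i => l.step i }
    exact le_iSup (fun q : LTSeries _ => (q.length : WithBot ℕ∞)) l'
  · obtain ⟨F, hF⟩ := hne
    rw [← hD F hF, ← ringKrullDim_quotient_facePrime (K := K)]
    exact ringKrullDim_le_of_surjective (Ideal.Quotient.factor (hI.le_facePrime hF))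
      (Ideal.Quotient.factor_surjective _)

theorem isPureIdeal [Finite σ] (hI : IsNonFaceIdeal Δ I) {D : ℕ}
    (hne : Δ.facets.Nonempty) (hD : ∀ F ∈ Δ.facets, F.card = D) : IsPureIdeal I D := by
  refine ⟨hI.ringKrullDim_quotient hne hD, fun P hP => ?_⟩
  obtain ⟨F, hF, rfl⟩ := hI.eq_facePrime_of_mem_associatedPrimes hP
  rw [ringKrullDim_quotient_facePrime, hD F hF]

/-! ### Hilbert series and face numbers -/

open scoped Classical in
theorem hilbertFn_eq [Fintype σ] (hI : IsNonFaceIdeal Δ I) (d : ℕ) :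
    hilbertFn I d = ((Finset.finsuppAntidiag (Finset.univ : Finset σ) d).filter
      (fun m => m.support ∈ Δ.faces)).card := by
  set s := (Finset.finsuppAntidiag (Finset.univ : Finset σ) d).filter
      (fun m => m.support ∈ Δ.faces) with hs
  have hmem : ∀ m, m ∈ s ↔ m.degree = d ∧ m.support ∈ Δ.faces := by
    intro m
    simp [hs, Finset.mem_finsuppAntidiag, Finsupp.degree_eq_sum]
  let v : s → MvPolynomial σ K ⧸ I := fun m => Ideal.Quotient.mkₐ K I (monomial m.1 1)
  have hli : LinearIndependent K v := by
    rw [Fintype.linearIndependent_iff]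
    intro g hg m
    have h0 : (Ideal.Quotient.mkₐ K I) (∑ i : s, monomial i.1 (g i)) = 0 := by
      rw [map_sum, ← hg]
      refine Finset.sum_congr rfl fun i _ => ?_
      change _ = g i • Ideal.Quotient.mkₐ K I (monomial i.1 1)
      rw [← map_smul, smul_monomial, smul_eq_mul, mul_one]
    have h1 := (hI _).1 (Ideal.Quotient.eq_zero_iff_mem.1 h0) m.1
    by_contra hne
    refine h1 ?_ ((hmem _).1 m.2).2
    rw [mem_support_iff, coeff_sum, Finset.sum_eq_single m]
    · simpa using hne
    · intro b _ hb
      rw [coeff_monomial, if_neg (fun h => hb (Subtype.ext h))]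
    · simp
  have hspan : (homogeneousSubmodule σ K d).map (Ideal.Quotient.mkₐ K I).toLinearMap =
      Submodule.span K (Set.range v) := by
    have : homogeneousSubmodule σ K d = restrictSupport K {m | m.degree = d} :=
      homogeneousSubmodule_eq_finsupp_supported ..
    rw [this, restrictSupport_eq_span, Submodule.map_span]
    apply le_antisymm
    · rw [Submodule.span_le]
      rintro _ ⟨_, ⟨m, hm, rfl⟩, rfl⟩
      by_cases hmΔ : m.support ∈ Δ.faces
      · exact Submodule.subset_span ⟨⟨m, (hmem m).2 ⟨hm, hmΔ⟩⟩, rfl⟩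
      · have : (Ideal.Quotient.mkₐ K I) (monomial m 1) = 0 :=
          Ideal.Quotient.eq_zero_iff_mem.2 ((hI.monomial_mem_iff m).2 hmΔ)
        change (Ideal.Quotient.mkₐ K I) (monomial m 1) ∈ _
        rw [this]
        exact zero_mem _
    · apply Submodule.span_mono
      rintro _ ⟨m, rfl⟩
      exact ⟨_, ⟨m.1, ((hmem _).1 m.2).1, rfl⟩, rfl⟩
  rw [hilbertFn, hspan, finrank_span_eq_card hli, Fintype.card_coe]

-- Monomials are sorted by their exact support; those with support `F` contribute `(X / (1 - X)) ^
-- F.card`.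
open scoped Classical in
theorem mk_hilbertFn_eq [Fintype σ] (hI : IsNonFaceIdeal Δ I) :
    PowerSeries.mk (fun d => (hilbertFn I d : ℤ)) =
      ∑ F ∈ Finset.univ.filter (· ∈ Δ.faces),
        (PowerSeries.X * PowerSeries.mk 1 : PowerSeries ℤ) ^ F.card := by
  ext d
  rw [PowerSeries.coeff_mk, hI.hilbertFn_eq, map_sum,
    Finset.card_eq_sum_card_fiberwise (f := fun m : σ →₀ ℕ => m.support)
      (t := Finset.univ.filter (· ∈ Δ.faces)) (by intro m hm; simpa using (Finset.mem_filter.1 hm).2),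
    Nat.cast_sum]
  refine Finset.sum_congr rfl fun F hF => ?_
  have hF' : F ∈ Δ.faces := by simpa using hF
  have hc : ∀ k : ℕ, PowerSeries.coeff k (PowerSeries.X * PowerSeries.mk 1 : PowerSeries ℤ) =
      if k = 0 then 0 else 1 := by
    rintro (_ | k) <;> simp [PowerSeries.coeff_succ_X_mul]
  rw [← Finset.prod_const, PowerSeries.coeff_prod, Finset.card_eq_sum_ones, Nat.cast_sum,
    Finset.sum_filter, Finset.sum_filter]
  rw [← Finset.sum_subset (Finset.finsuppAntidiag_mono (Finset.subset_univ F) d)]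
  · refine Finset.sum_congr rfl fun m hm => ?_
    have hm' := (Finset.mem_finsuppAntidiag.1 hm).2
    simp only [hc]
    by_cases h : m.support = F
    · rw [if_pos (h ▸ hF'), if_pos h, Nat.cast_one, Finset.prod_eq_one]
      intro i hi
      rw [if_neg (Finsupp.mem_support_iff.1 (h ▸ hi))]
    · obtain ⟨i, hi, hi'⟩ : ∃ i ∈ F, i ∉ m.support := by
        by_contra! hcon
        exact h (Finset.Subset.antisymm hm' hcon)
      rw [if_neg h, Finset.prod_eq_zero hi (by simpa using hi')]
      simp
  · intro m hm hm'
    have h : m.support ≠ F := by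
      rintro rfl
      apply hm'
      rw [Finset.mem_finsuppAntidiag] at hm ⊢
      refine ⟨?_, subset_rfl⟩
      rw [← hm.1]
      exact Finset.sum_subset (Finset.subset_univ _) fun i _ hi => by simpa using hi
    simp [h]

open scoped Classical in
/-- The Hilbert series in terms of the face numbers. -/
theorem mk_hilbertFn_mul [Fintype σ] (hI : IsNonFaceIdeal Δ I) {D : ℕ}
    (hD : ∀ F ∈ Δ.faces, F.card ≤ D) :
    PowerSeries.mk (fun d => (hilbertFn I d : ℤ)) * (1 - PowerSeries.X) ^ D =
      ((∑ F ∈ Finset.univ.filter (· ∈ Δ.faces),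
        Polynomial.X ^ F.card * (1 - Polynomial.X) ^ (D - F.card) : Polynomial ℤ) :
          PowerSeries ℤ) := by
  rw [hI.mk_hilbertFn_eq, Finset.sum_mul, ← Polynomial.coeToPowerSeries.ringHom_apply, map_sum]
  refine Finset.sum_congr rfl fun F hF => ?_
  have hF' := hD F (by simpa using hF)
  simp only [map_mul, map_pow, map_sub, map_one, Polynomial.coeToPowerSeries.ringHom_apply,
    Polynomial.coe_X]
  calc _ = (PowerSeries.X : PowerSeries ℤ) ^ F.card *
        (PowerSeries.mk 1 * (1 - PowerSeries.X)) ^ F.card *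
        (1 - PowerSeries.X) ^ (D - F.card) := by
        obtain ⟨k, rfl⟩ := Nat.exists_eq_add_of_le hF'
        rw [pow_add, Nat.add_sub_cancel_left, mul_pow, mul_pow]
        ring
    _ = _ := by rw [PowerSeries.mk_one_mul_one_sub_eq_one, one_pow, mul_one]

open scoped Classical in
/-- The number of faces of largest size is the value at `1` of the numerator of the Hilbert
series. -/
theorem eval_one_eq_card [Fintype σ] (hI : IsNonFaceIdeal Δ I) {D : ℕ}
    (hD : ∀ F ∈ Δ.faces, F.card ≤ D) {h : Polynomial ℤ}
    (hh : PowerSeries.mk (fun d => (hilbertFn I d : ℤ)) * (1 - PowerSeries.X) ^ D =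
      (h : PowerSeries ℤ)) :
    h.eval 1 = ((Finset.univ.filter fun F => F ∈ Δ.faces ∧ F.card = D).card : ℤ) := by
  rw [hI.mk_hilbertFn_mul hD] at hh
  rw [← Polynomial.coe_injective _ hh, Polynomial.eval_finsetSum, ← Finset.filter_filter,
    Finset.card_filter, Nat.cast_sum]
  refine Finset.sum_congr rfl fun F hF => ?_
  have hF' := hD F (by simpa using hF)
  -- At 1 the factor `(1 - X) ^ (D - F.card)` vanishes unless `F` has the top size.
  by_cases h : F.card = D
  · simp [h]
  · simp [h, show D - F.card ≠ 0 by omega]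

end IsNonFaceIdeal

/-! ### The simplicial complex of `H(2,n)` -/

/-- The sets of cells of an `n × n` matrix whose off-diagonal part uses disjoint sets of rows and
columns and runs weakly from north-east to south-west. -/
def segreComplex (n : ℕ) : FaceComplex (Fin n × Fin n) where
  faces := {F | ∀ p ∈ F, ∀ q ∈ F, p.1 ≠ p.2 → q.1 ≠ q.2 →
    p.1 ≠ q.2 ∧ (p.1 < q.1 → q.2 ≤ p.2)}
  down_closed _ hF _ hG p hp q hq := hF p (hG hp) q (hG hq)

namespace segreComplex

variable {n : ℕ}

theorem mem_faces {F : Finset (Fin n × Fin n)} :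
    F ∈ (segreComplex n).faces ↔ ∀ p ∈ F, ∀ q ∈ F, p.1 ≠ p.2 → q.1 ≠ q.2 →
      p.1 ≠ q.2 ∧ (p.1 < q.1 → q.2 ≤ p.2) := Iff.rfl

/-- The diagonal cells. -/
def diag (n : ℕ) : Finset (Fin n × Fin n) := Finset.univ.filter fun p => p.1 = p.2

theorem mem_diag {p : Fin n × Fin n} : p ∈ diag n ↔ p.1 = p.2 := by simp [diag]

theorem card_diag : (diag n).card = n := by
  have : diag n = Finset.univ.image fun i : Fin n => (i, i) := by
    ext ⟨i, j⟩
    simp [mem_diag, eq_comm]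
  rw [this, Finset.card_image_of_injective _ fun i j h => (Prod.ext_iff.1 h).1]
  simp

/-- The face condition only constrains off-diagonal cells, so the complex is a cone over each
diagonal cell. -/
theorem union_diag_mem_faces {F : Finset (Fin n × Fin n)} (hF : F ∈ (segreComplex n).faces) :
    F ∪ diag n ∈ (segreComplex n).faces := by
  intro p hp q hq hp' hq'
  rw [Finset.mem_union, mem_diag] at hp hq
  exact hF p (hp.resolve_right hp') q (hq.resolve_right hq') hp' hq'

/-- The faces without diagonal cells. -/
def OffDiag (G : Finset (Fin n × Fin n)) : Prop :=
  G ∈ (segreComplex n).faces ∧ ∀ p ∈ G, p.1 ≠ p.2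

theorem OffDiag.ne {G : Finset (Fin n × Fin n)} (hG : OffDiag G) {p q : Fin n × Fin n}
    (hp : p ∈ G) (hq : q ∈ G) : p.1 ≠ q.2 :=
  (hG.1 p hp q hq (hG.2 p hp) (hG.2 q hq)).1

theorem OffDiag.le {G : Finset (Fin n × Fin n)} (hG : OffDiag G) {p q : Fin n × Fin n}
    (hp : p ∈ G) (hq : q ∈ G) (h : p.1 < q.1) : q.2 ≤ p.2 :=
  (hG.1 p hp q hq (hG.2 p hp) (hG.2 q hq)).2 h

/-- The hypotheses say precisely that `(i, j)` is compatible with every cell of `G`. -/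
theorem OffDiag.mem_of_maximal {G : Finset (Fin n × Fin n)} (hG : Maximal OffDiag G)
    {i j : Fin n} (hij : i ≠ j) (hrow : ∀ p ∈ G, i ≠ p.2) (hcol : ∀ p ∈ G, p.1 ≠ j)
    (h₁ : ∀ p ∈ G, p.1 < i → j ≤ p.2) (h₂ : ∀ p ∈ G, i < p.1 → p.2 ≤ j) : (i, j) ∈ G := by
  refine hG.2 (y := insert (i, j) G) ⟨?_, ?_⟩ (Finset.subset_insert _ G)
    (Finset.mem_insert_self _ G)
  · intro p hp q hq _ _
    rcases Finset.mem_insert.1 hp with rfl | hp' <;> rcases Finset.mem_insert.1 hq with rfl | hq'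
    · exact ⟨hij, fun h => absurd h (lt_irrefl _)⟩
    · exact ⟨hrow q hq', h₂ q hq'⟩
    · exact ⟨hcol p hp', h₁ p hp'⟩
    · exact ⟨hG.1.ne hp' hq', hG.1.le hp' hq'⟩
  · intro p hp
    rcases Finset.mem_insert.1 hp with rfl | hp
    · exact hij
    · exact hG.1.2 p hp

theorem OffDiag.nonempty_of_maximal {G : Finset (Fin n × Fin n)} (hG : Maximal OffDiag G)
    (hn : 2 ≤ n) : G.Nonempty := by
  by_contra h
  rw [Finset.not_nonempty_iff_eq_empty] at h
  subst h
  have := OffDiag.mem_of_maximal hG (i := ⟨0, by omega⟩) (j := ⟨1, by omega⟩)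
      (by simp)
    (by simp) (by simp) (by simp) (by simp)
  simp at this

/-- In a maximal face every index is the index of a row or of a column. -/
theorem OffDiag.exists_row_or_column {G : Finset (Fin n × Fin n)} (hG : Maximal OffDiag G)
    (hne : G.Nonempty) (t : Fin n) : (∃ p ∈ G, p.1 = t) ∨ ∃ p ∈ G, p.2 = t := by
  by_contra! h
  obtain ⟨ht₁, ht₂⟩ := h
  -- An unused index `t` could serve as a new row: it suffices to find a column already in use where
  -- the staircase passes row `t`.
  suffices ∃ q ∈ G, (∀ p ∈ G, p.1 < t → q.2 ≤ p.2) ∧ ∀ p ∈ G, t < p.1 → p.2 ≤ q.2 by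
    obtain ⟨q, hq, h₁, h₂⟩ := this
    have := OffDiag.mem_of_maximal hG (i := t) (j := q.2) (Ne.symm (ht₂ q hq))
      (fun p hp => (ht₂ p hp).symm) (fun p hp => hG.1.ne hp hq) h₁ h₂
    exact ht₁ _ this rfl
  -- Use the smallest column occurring above row `t`, or the largest column of all if nothing lies
  -- above.
  by_cases hlt : (G.filter fun p => p.1 < t).Nonempty
  · obtain ⟨q, hq, hmin⟩ := Finset.exists_min_image _ Prod.snd hlt
    rw [Finset.mem_filter] at hq
    exact ⟨q, hq.1, fun p hp hpt => hmin p (Finset.mem_filter.2 ⟨hp, hpt⟩),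
      fun p hp hpt => hG.1.le hq.1 hp (hq.2.trans hpt)⟩
  · obtain ⟨q, hq, hmax⟩ := Finset.exists_max_image _ Prod.snd hne
    exact ⟨q, hq, fun p hp hpt => absurd ⟨p, Finset.mem_filter.2 ⟨hp, hpt⟩⟩ hlt,
      fun p hp _ => hmax p hp⟩

/-- The maximal faces off the diagonal have `n - 1` elements. -/
theorem OffDiag.card_of_maximal {G : Finset (Fin n × Fin n)} (hG : Maximal OffDiag G)
    (hn : 1 ≤ n) : G.card + 1 = n := by
  classical
  rcases Nat.lt_or_ge n 2 with h2 | h2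
  · obtain rfl : n = 1 := by omega
    have : G = ∅ := by
      rw [Finset.eq_empty_iff_forall_notMem]
      intro p hp
      exact hG.1.2 p hp (Subsingleton.elim _ _)
    simp [this]
  have hne := OffDiag.nonempty_of_maximal hG h2
  -- `A` holds the last cell of each row and `B` the top cell of each column, so they count the rows
  -- and columns in use. These partition the `n` indices; `A` and `B` cover `G` and share only the
  -- north-east corner.
  let A := G.filter fun p => ∀ q ∈ G, q.1 = p.1 → q.2 ≤ p.2
  let B := G.filter fun p => ∀ q ∈ G, q.2 = p.2 → p.1 ≤ q.1
  have hA : A.card = (G.image Prod.fst).card := by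
    rw [← Finset.card_image_of_injOn (s := A) (f := Prod.fst)]
    · congr 1
      ext i
      simp only [Finset.mem_image]
      constructor
      · rintro ⟨p, hp, rfl⟩
        exact ⟨p, (Finset.mem_filter.1 hp).1, rfl⟩
      · rintro ⟨p, hp, rfl⟩
        obtain ⟨q, hq, hmax⟩ := Finset.exists_max_image (G.filter fun q => q.1 = p.1) Prod.snd
          ⟨p, by simpa using hp⟩
        rw [Finset.mem_filter] at hq
        exact ⟨q, Finset.mem_filter.2 ⟨hq.1, fun r hr hrq =>
          hmax r (Finset.mem_filter.2 ⟨hr, hrq.trans hq.2⟩)⟩, hq.2⟩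
    · intro p hp q hq h
      have hp := Finset.mem_filter.1 hp
      have hq := Finset.mem_filter.1 hq
      exact Prod.ext h (le_antisymm (hq.2 p hp.1 h) (hp.2 q hq.1 h.symm))
  have hB : B.card = (G.image Prod.snd).card := by
    rw [← Finset.card_image_of_injOn (s := B) (f := Prod.snd)]
    · congr 1
      ext i
      simp only [Finset.mem_image]
      constructor
      · rintro ⟨p, hp, rfl⟩
        exact ⟨p, (Finset.mem_filter.1 hp).1, rfl⟩
      · rintro ⟨p, hp, rfl⟩
        obtain ⟨q, hq, hmin⟩ := Finset.exists_min_image (G.filter fun q => q.2 = p.2) Prod.fst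
          ⟨p, by simpa using hp⟩
        rw [Finset.mem_filter] at hq
        exact ⟨q, Finset.mem_filter.2 ⟨hq.1, fun r hr hrq =>
          hmin r (Finset.mem_filter.2 ⟨hr, hrq.trans hq.2⟩)⟩, hq.2⟩
    · intro p hp q hq h
      have hp := Finset.mem_filter.1 hp
      have hq := Finset.mem_filter.1 hq
      exact Prod.ext (le_antisymm (hp.2 q hq.1 h.symm) (hq.2 p hp.1 h)) h
  have hrc : (G.image Prod.fst).card + (G.image Prod.snd).card = n := by
    rw [← Finset.card_union_of_disjoint]
    · have : G.image Prod.fst ∪ G.image Prod.snd = Finset.univ := by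
        rw [Finset.eq_univ_iff_forall]
        intro t
        rw [Finset.mem_union, Finset.mem_image, Finset.mem_image]
        exact OffDiag.exists_row_or_column hG hne t
      rw [this, Finset.card_univ, Fintype.card_fin]
    · rw [Finset.disjoint_left]
      intro t ht ht'
      obtain ⟨p, hp, rfl⟩ := Finset.mem_image.1 ht
      obtain ⟨q, hq, h⟩ := Finset.mem_image.1 ht'
      exact hG.1.ne hp hq h.symm
  have hunion : A ∪ B = G := by
    ext c
    simp only [A, B, Finset.mem_union, Finset.mem_filter, ← and_or_left, and_iff_left_iff_imp]
    intro hc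
    by_contra! h
    obtain ⟨⟨p, hp, hp₁, hp₂⟩, q, hq, hq₁, hq₂⟩ := h
    exact absurd (hG.1.le hq hp (hp₁ ▸ hq₂)) (not_le.2 (hq₁ ▸ hp₂))
  obtain ⟨a, ha, hamin⟩ := Finset.exists_min_image G Prod.fst hne
  obtain ⟨b, hb, hbmax⟩ := Finset.exists_max_image G Prod.snd hne
  have hinter : A ∩ B = {(a.1, b.2)} := by
    have hab : (a.1, b.2) ∈ G := OffDiag.mem_of_maximal hG (hG.1.ne ha hb)
      (fun p hp => hG.1.ne ha hp) (fun p hp => hG.1.ne hp hb)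
      (fun p hp h => absurd (hamin p hp) (not_le.2 h)) (fun p hp _ => hbmax p hp)
    ext c
    rw [Finset.mem_inter, Finset.mem_singleton]
    constructor
    · rintro ⟨hcA, hcB⟩
      obtain ⟨hc, hcA⟩ := Finset.mem_filter.1 hcA
      obtain ⟨-, hcB⟩ := Finset.mem_filter.1 hcB
      have hrow : ∀ p ∈ G, c.1 ≤ p.1 := by
        by_contra! hcon
        -- If `c` had rows above it, the cell of column `c.2` in the nearest such row would be
        -- compatible with `G`, hence in `G`, so `c` would not be the top of its column.
        obtain ⟨p, hp, hpc⟩ := hcon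
        obtain ⟨q, hq, hqmax⟩ := Finset.exists_max_image (G.filter fun q => q.1 < c.1) Prod.fst
          ⟨p, Finset.mem_filter.2 ⟨hp, hpc⟩⟩
        rw [Finset.mem_filter] at hq
        have hmem : (q.1, c.2) ∈ G := by
          refine OffDiag.mem_of_maximal hG (hG.1.ne hq.1 hc) (fun p hp => hG.1.ne hq.1 hp)
            (fun p hp => hG.1.ne hp hc) (fun p hp h => hG.1.le hp hc (lt_trans h hq.2)) ?_
          intro r hr hqr
          rcases lt_trichotomy r.1 c.1 with h | h | h
          · exact absurd (hqmax r (Finset.mem_filter.2 ⟨hr, h⟩)) (not_le.2 hqr)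
          · exact hcA r hr h
          · exact hG.1.le hc hr h
        exact absurd (hcB _ hmem rfl) (not_le.2 hq.2)
      have h1 : c.1 = a.1 := le_antisymm (hrow a ha) (hamin c hc)
      refine Prod.ext h1 (le_antisymm (hbmax c hc) ?_)
      exact hcA _ hab h1.symm
    · rintro rfl
      exact ⟨Finset.mem_filter.2 ⟨hab, fun q hq _ => hbmax q hq⟩,
        Finset.mem_filter.2 ⟨hab, fun q hq _ => hamin q hq⟩⟩
  have := Finset.card_union_add_card_inter A B
  rw [hunion, hinter, Finset.card_singleton] at this
  omega

theorem exists_maximal_offDiag {G : Finset (Fin n × Fin n)} (hG : OffDiag G) :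
    ∃ M, Maximal OffDiag M ∧ G ⊆ M := by
  obtain ⟨M, h, hM⟩ := (Set.toFinite {G : Finset (Fin n × Fin n) | OffDiag G}).exists_le_maximal hG
  exact ⟨M, hM, h⟩

theorem OffDiag.card_le {G : Finset (Fin n × Fin n)} (hG : OffDiag G) (hn : 1 ≤ n) :
    G.card ≤ n - 1 := by
  obtain ⟨M, hM, h⟩ := exists_maximal_offDiag hG
  have := OffDiag.card_of_maximal hM hn
  have := Finset.card_le_card h
  omega

theorem offDiag_sdiff_diag {F : Finset (Fin n × Fin n)} (hF : F ∈ (segreComplex n).faces) :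
    OffDiag (F \ diag n) :=
  ⟨(segreComplex n).down_closed F hF _ Finset.sdiff_subset,
    fun _ hp h => (Finset.mem_sdiff.1 hp).2 (mem_diag.2 h)⟩

theorem OffDiag.disjoint_diag {G : Finset (Fin n × Fin n)} (hG : OffDiag G) :
    Disjoint G (diag n) :=
  Finset.disjoint_left.2 fun p hp h => hG.2 p hp (mem_diag.1 h)

theorem OffDiag.maximal_iff {G : Finset (Fin n × Fin n)} (hn : 1 ≤ n) :
    Maximal OffDiag G ↔ OffDiag G ∧ G.card = n - 1 := by
  constructor
  · intro hG
    have := OffDiag.card_of_maximal hG hn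
    exact ⟨hG.1, by omega⟩
  · rintro ⟨hG, hcard⟩
    refine ⟨hG, fun M hM h => ?_⟩
    exact (Finset.eq_of_subset_of_card_le h (by rw [hcard]; exact hM.card_le hn)).ge

theorem card_le {F : Finset (Fin n × Fin n)} (hF : F ∈ (segreComplex n).faces) (hn : 1 ≤ n) :
    F.card ≤ 2 * n - 1 := by
  have h1 := (offDiag_sdiff_diag hF).card_le hn
  have h2 := Finset.card_le_card_sdiff_add_card (s := F) (t := diag n)
  rw [card_diag] at h2
  omega

theorem facets_eq (hn : 1 ≤ n) :
    (segreComplex n).facets = {F | F ∈ (segreComplex n).faces ∧ F.card = 2 * n - 1} := by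
  ext F
  constructor
  · intro hF
    have hd : diag n ⊆ F := fun p hp =>
      hF.2 (union_diag_mem_faces hF.1) Finset.subset_union_left (Finset.mem_union_right _ hp)
    have hmax : Maximal OffDiag (F \ diag n) := by
      refine ⟨offDiag_sdiff_diag hF.1, fun M hM h p hp => ?_⟩
      refine Finset.mem_sdiff.2 ⟨?_, fun h => hM.2 p hp (mem_diag.1 h)⟩
      refine hF.2 (union_diag_mem_faces hM.1) (fun q hq => ?_) (Finset.mem_union_left _ hp)
      by_cases hq' : q ∈ diag n
      · exact Finset.mem_union_right _ hq'
      · exact Finset.mem_union_left _ (h (Finset.mem_sdiff.2 ⟨hq, hq'⟩))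
    have h1 := OffDiag.card_of_maximal hmax hn
    have h2 := Finset.card_sdiff_add_card_eq_card hd
    rw [card_diag] at h2
    exact ⟨hF.1, by omega⟩
  · rintro ⟨hF, hcard⟩
    refine ⟨hF, fun M hM h => ?_⟩
    exact (Finset.eq_of_subset_of_card_le h (by rw [hcard]; exact card_le hM hn)).ge

theorem conePoints_eq :
    (segreComplex n).conePoints = Set.range fun i : Fin n => (i, i) := by
  ext p
  constructor
  · intro hp
    by_contra hne
    have hoff : p.1 ≠ p.2 := fun h => hne ⟨p.1, Prod.ext rfl h⟩
    -- The transposed cell is a face incompatible with `p`, so a facet containing it omits `p`.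
    have hface : ({(p.2, p.1)} : Finset (Fin n × Fin n)) ∈ (segreComplex n).faces := by
      rw [mem_faces]
      simp only [Finset.mem_singleton]
      rintro _ rfl _ rfl _ _
      exact ⟨hoff.symm, fun h => absurd h (lt_irrefl _)⟩
    obtain ⟨F, hF, hsub⟩ := (segreComplex n).exists_facet_superset hface
    exact (hF.1 p (hp F hF) (p.2, p.1) (hsub (Finset.mem_singleton_self _)) hoff hoff.symm).1 rfl
  · rintro ⟨i, rfl⟩ F hF
    exact hF.2 (union_diag_mem_faces hF.1) Finset.subset_union_left
      (Finset.mem_union_right _ (mem_diag.2 rfl))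

theorem core_facets_eq (hn : 1 ≤ n) :
    (segreComplex n).core.facets = {G | OffDiag G ∧ G.card = n - 1} := by
  have h : ∀ G, G ∈ (segreComplex n).core.faces ↔ OffDiag G := by
    intro G
    change (_ ∧ _) ↔ (_ ∧ _)
    rw [conePoints_eq]
    refine and_congr Iff.rfl (forall₂_congr fun p _ => not_congr ?_)
    exact ⟨fun ⟨i, hi⟩ => hi ▸ rfl, fun h => ⟨p.1, Prod.ext rfl h⟩⟩
  ext G
  rw [Set.mem_ofPred_eq, ← OffDiag.maximal_iff hn, FaceComplex.facets,
    show (segreComplex n).core.faces = {G | OffDiag G} from Set.ext h]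
  rfl

/-- Removing the diagonal is a bijection between the facets of the complex and those of its
core. -/
theorem ncard_core_facets (hn : 1 ≤ n) :
    (segreComplex n).core.facets.ncard = (segreComplex n).facets.ncard := by
  rw [core_facets_eq hn, facets_eq hn]
  refine Set.ncard_congr (fun G _ => G ∪ diag n) ?_ ?_ ?_
  · rintro G ⟨hG, hcard⟩
    refine ⟨union_diag_mem_faces hG.1, ?_⟩
    rw [Finset.card_union_of_disjoint hG.disjoint_diag, hcard, card_diag]
    omega
  · rintro G G' ⟨hG, -⟩ ⟨hG', -⟩ h
    rw [← Finset.union_sdiff_cancel_right hG.disjoint_diag, h,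
      Finset.union_sdiff_cancel_right hG'.disjoint_diag]
  · rintro F ⟨hF, hcard⟩
    have hoff := offDiag_sdiff_diag hF
    have hle := hoff.card_le hn
    have hu := Finset.card_union_of_disjoint hoff.disjoint_diag
    have hle' : F.card ≤ (F \ diag n ∪ diag n).card :=
      Finset.card_le_card (by rw [Finset.sdiff_union_self_eq_union]; exact Finset.subset_union_left)
    have hFu : F = F \ diag n ∪ diag n := by
      apply Finset.eq_of_subset_of_card_le
      · rw [Finset.sdiff_union_self_eq_union]
        exact Finset.subset_union_left
      · rw [hu, hcard, card_diag]
        omega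
    refine ⟨F \ diag n, ⟨hoff, ?_⟩, hFu.symm⟩
    rw [hu, card_diag] at hle'
    omega

end segreComplex

/-! ### The Gröbner basis of the Segre ideal -/

section RevLex

variable {σ : Type*}

theorem pair_le_iff {p q : σ} (h : p ≠ q) (m : σ →₀ ℕ) :
    Finsupp.single p 1 + Finsupp.single q 1 ≤ m ↔ p ∈ m.support ∧ q ∈ m.support := by
  classical
  rw [Finsupp.mem_support_iff, Finsupp.mem_support_iff, Finsupp.le_def]
  constructor
  · intro H
    have hp := H p
    have hq := H q
    simp only [Finsupp.add_apply, Finsupp.single_eq_same] at hp hq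
    omega
  · rintro ⟨hp, hq⟩ i
    simp only [Finsupp.add_apply, Finsupp.single_apply]
    split_ifs with h1 h2 h2
    · exact absurd (h1.trans h2.symm) h
    · subst h1; omega
    · subst h2; omega
    · omega

-- The smallest variable decides in reverse lexicographic order, and here it occurs only on the
-- left.
open scoped MonomialOrder in
theorem revLexOrder_pair_lt [Finite σ] (ord : LinearOrder σ) {a b p q : σ}
    (h : (ord.lt a p ∧ ord.lt a q) ∨ (ord.lt b p ∧ ord.lt b q)) :
    (Finsupp.single a 1 + Finsupp.single b 1 : σ →₀ ℕ) ≺[revLexOrder ord]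
      (Finsupp.single p 1 + Finsupp.single q 1) := by
  classical
  let _ := ord
  have key : ∀ v w : σ, v ≤ w → v < p → v < q →
      (Finsupp.single v 1 + Finsupp.single w 1 : σ →₀ ℕ) ≺[revLexOrder ord]
        (Finsupp.single p 1 + Finsupp.single q 1) := by
    intro v w hvw hp hq
    rw [revLexOrder_lt_iff]
    refine Or.inr ⟨by simp, v, fun u hu => ?_, ?_⟩
    · have hu : u < v := hu
      simp [hu.ne', (hu.trans hp).ne', (hu.trans hq).ne',
        (hu.trans_le hvw).ne']
    · simp [Finsupp.single_apply, hp.ne', hq.ne']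
  have h' : (a < p ∧ a < q) ∨ (b < p ∧ b < q) := h
  rcases le_total a b with hab | hab
  · refine key a b hab ?_ ?_
    · exact h'.elim (fun h => h.1) fun h => hab.trans_lt h.1
    · exact h'.elim (fun h => h.2) fun h => hab.trans_lt h.2
  · rw [add_comm (Finsupp.single a 1)]
    refine key b a hab ?_ ?_
    · exact h'.elim (fun h => hab.trans_lt h.1) fun h => h.1
    · exact h'.elim (fun h => hab.trans_lt h.2) fun h => h.2

end RevLex

/-! ### Monomials on faces and the toric map -/

section Segre

variable {n : ℕ}

/-- The exponent vector of the image of a monomial under `x_ij ↦ r_i s_j`. -/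
noncomputable def segreExp : (Fin n × Fin n →₀ ℕ) →+ (Fin n ⊕ Fin n →₀ ℕ) :=
  Finsupp.liftAddHom fun p =>
    Finsupp.singleAddHom (Sum.inl p.1) + Finsupp.singleAddHom (Sum.inr p.2)

theorem segreExp_single (p : Fin n × Fin n) (k : ℕ) :
    segreExp (Finsupp.single p k) =
      Finsupp.single (Sum.inl p.1) k + Finsupp.single (Sum.inr p.2) k := by
  simp [segreExp]

theorem segreExp_eq_sum (m : Fin n × Fin n →₀ ℕ) :
    segreExp m = ∑ p ∈ m.support,
      (Finsupp.single (Sum.inl p.1) (m p) + Finsupp.single (Sum.inr p.2) (m p)) := by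
  rw [segreExp, Finsupp.liftAddHom_apply, Finsupp.sum]
  rfl

theorem segreExp_inl_ne_zero {m : Fin n × Fin n →₀ ℕ} {i : Fin n} :
    segreExp m (Sum.inl i) ≠ 0 ↔ ∃ p ∈ m.support, p.1 = i := by
  classical
  rw [segreExp_eq_sum, Finsupp.finsetSum_apply, Ne, Finset.sum_eq_zero_iff]
  push Not
  refine exists_congr fun p => and_congr_right fun hp => ?_
  have := Finsupp.mem_support_iff.1 hp
  simp [Finsupp.single_apply, this]

theorem segreExp_inr_ne_zero {m : Fin n × Fin n →₀ ℕ} {j : Fin n} :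
    segreExp m (Sum.inr j) ≠ 0 ↔ ∃ p ∈ m.support, p.2 = j := by
  classical
  rw [segreExp_eq_sum, Finsupp.finsetSum_apply, Ne, Finset.sum_eq_zero_iff]
  push Not
  refine exists_congr fun p => and_congr_right fun hp => ?_
  have := Finsupp.mem_support_iff.1 hp
  simp [Finsupp.single_apply, this]

namespace segreComplex

/-- Off-diagonal cells of a face never use one index both as row and as column, so one of the two
cells is diagonal. -/
theorem diag_mem_of_mem {F : Finset (Fin n × Fin n)} (hF : F ∈ (segreComplex n).faces)
    {p q : Fin n × Fin n} (hp : p ∈ F) (hq : q ∈ F) (h : p.1 = q.2) : (p.1, p.1) ∈ F := by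
  by_cases hp' : p.1 = p.2
  · exact (Prod.ext rfl hp' : (p.1, p.1) = p) ▸ hp
  by_cases hq' : q.1 = q.2
  · exact (Prod.ext (h.trans hq'.symm) h : (p.1, p.1) = q) ▸ hq
  · exact absurd h (hF p hp q hq hp' hq').1

theorem corner_mem {F : Finset (Fin n × Fin n)} (hF : OffDiag F)
    {p q : Fin n × Fin n} (hp : p ∈ F) (hq : q ∈ F) (hrow : ∀ r ∈ F, p.1 ≤ r.1)
    (hcol : ∀ r ∈ F, r.2 ≤ q.2) : (p.1, q.2) ∈ F := by
  rcases (hrow q hq).eq_or_lt with h | h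
  · exact (Prod.ext h rfl : (p.1, q.2) = q) ▸ hq
  · have h' : q.2 = p.2 := le_antisymm (hF.le hp hq h) (hcol p hp)
    exact (Prod.ext rfl h' : (p.1, q.2) = p) ▸ hp

/-- Two non-empty faces which meet the same rows and the same columns have a common cell. -/
theorem exists_common_cell {F F' : Finset (Fin n × Fin n)} (hF : F ∈ (segreComplex n).faces)
    (hF' : F' ∈ (segreComplex n).faces) (hne : F.Nonempty)
    (hrow : ∀ i, (∃ p ∈ F, p.1 = i) ↔ ∃ p ∈ F', p.1 = i)
    (hcol : ∀ j, (∃ p ∈ F, p.2 = j) ↔ ∃ p ∈ F', p.2 = j) : ∃ c, c ∈ F ∧ c ∈ F' := by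
  -- An index that is both row and column forces its diagonal cell into both faces. Otherwise both
  -- faces avoid the diagonal and share their north-east corner.
  by_cases h : ∃ p ∈ F, ∃ q ∈ F, p.1 = q.2
  · obtain ⟨p, hp, q, hq, h⟩ := h
    obtain ⟨p', hp', hpp⟩ := (hrow p.1).1 ⟨p, hp, rfl⟩
    obtain ⟨q', hq', hqq⟩ := (hcol p.1).1 ⟨q, hq, h.symm⟩
    refine ⟨(p.1, p.1), diag_mem_of_mem hF hp hq h, ?_⟩
    rw [← hpp]
    exact diag_mem_of_mem hF' hp' hq' (hpp.trans hqq.symm)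
  · push Not at h
    have hoff : OffDiag F := ⟨hF, fun p hp => h p hp p hp⟩
    have hoff' : OffDiag F' := by
      refine ⟨hF', fun p hp hpp => ?_⟩
      obtain ⟨r, hr, hr'⟩ := (hrow p.1).2 ⟨p, hp, rfl⟩
      obtain ⟨s, hs, hs'⟩ := (hcol p.1).2 ⟨p, hp, hpp.symm⟩
      exact h r hr s hs (hr'.trans hs'.symm)
    obtain ⟨p, hp, hpmin⟩ := Finset.exists_min_image F Prod.fst hne
    obtain ⟨q, hq, hqmax⟩ := Finset.exists_max_image F Prod.snd hne
    refine ⟨(p.1, q.2), corner_mem hoff hp hq hpmin hqmax, ?_⟩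
    obtain ⟨p', hp', hpp⟩ := (hrow p.1).1 ⟨p, hp, rfl⟩
    obtain ⟨q', hq', hqq⟩ := (hcol q.2).1 ⟨q, hq, rfl⟩
    rw [← hpp, ← hqq]
    refine corner_mem hoff' hp' hq' (fun r hr => ?_) fun r hr => ?_
    · obtain ⟨s, hs, hs'⟩ := (hrow r.1).2 ⟨r, hr, rfl⟩
      rw [hpp, ← hs']
      exact hpmin s hs
    · obtain ⟨s, hs, hs'⟩ := (hcol r.2).2 ⟨r, hr, rfl⟩
      rw [hqq, ← hs']
      exact hqmax s hs

/-- A monomial supported on a face is determined by its image under `x_ij ↦ r_i s_j`. -/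
theorem eq_of_segreExp_eq (m m' : Fin n × Fin n →₀ ℕ)
    (hm : m.support ∈ (segreComplex n).faces) (hm' : m'.support ∈ (segreComplex n).faces)
    (h : segreExp m = segreExp m') : m = m' := by
  obtain ⟨d, hd⟩ : ∃ d, m.degree = d := ⟨_, rfl⟩
  induction d generalizing m m' with
  | zero =>
    rw [Finsupp.degree_eq_zero_iff] at hd
    subst hd
    by_contra hne
    obtain ⟨p, hp⟩ := Finsupp.support_nonempty_iff.2 (Ne.symm hne)
    have := segreExp_inl_ne_zero.2 ⟨p, hp, rfl⟩
    rw [← h] at this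
    simp at this
  | succ d ih =>
    have hne : m.support.Nonempty := by
      rw [Finsupp.support_nonempty_iff]
      rintro rfl
      simp at hd
    obtain ⟨c, hc, hc'⟩ := exists_common_cell hm hm' hne
      (fun i => by rw [← segreExp_inl_ne_zero, ← segreExp_inl_ne_zero, h])
      (fun j => by rw [← segreExp_inr_ne_zero, ← segreExp_inr_ne_zero, h])
    have hle : ∀ u : Fin n × Fin n →₀ ℕ, c ∈ u.support → ∃ v, u = Finsupp.single c 1 + v := by
      intro u hu
      refine exists_add_of_le (Finsupp.single_le_iff.2 ?_)
      exact Nat.one_le_iff_ne_zero.2 (Finsupp.mem_support_iff.1 hu)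
    obtain ⟨v, rfl⟩ := hle m hc
    obtain ⟨v', rfl⟩ := hle m' hc'
    rw [map_add, map_add, add_right_inj] at h
    rw [map_add, Finsupp.degree_single] at hd
    have hs : ∀ u : Fin n × Fin n →₀ ℕ, u.support ⊆ (Finsupp.single c 1 + u).support := by
      intro u i hi
      rw [Finsupp.mem_support_iff, Finsupp.add_apply]
      have := Finsupp.mem_support_iff.1 hi
      omega
    rw [ih v v' ((segreComplex n).down_closed _ hm _ (hs v))
      ((segreComplex n).down_closed _ hm' _ (hs v')) h (by omega)]

end segreComplex

open segreComplex

/-! ### Reduction modulo the 2-minors -/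

variable {K : Type*} [Field K]

theorem aeval_monomial_segre (m : Fin n × Fin n →₀ ℕ) (c : K) :
    aeval (fun p : Fin n × Fin n =>
      (X (Sum.inl p.1) * X (Sum.inr p.2) : MvPolynomial (Fin n ⊕ Fin n) K)) (monomial m c) =
      monomial (segreExp m) c := by
  have h1 : ∀ m : Fin n × Fin n →₀ ℕ, aeval (fun p : Fin n × Fin n =>
      (X (Sum.inl p.1) * X (Sum.inr p.2) : MvPolynomial (Fin n ⊕ Fin n) K)) (monomial m (1 : K)) =
      monomial (segreExp m) 1 := by
    intro m
    induction m using Finsupp.induction_linear with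
    | zero => simp
    | add a b ha hb =>
      have hab : monomial (a + b) (1 : K) = monomial a 1 * monomial b 1 := by
        rw [monomial_mul, mul_one]
      rw [hab, map_mul, ha, hb, monomial_mul, mul_one, map_add]
    | single p k =>
      rw [segreExp_single, ← X_pow_eq_monomial, map_pow, aeval_X, mul_pow, X_pow_eq_monomial,
        X_pow_eq_monomial, monomial_mul, mul_one]
  have h2 : monomial m c = C c * monomial m (1 : K) := by rw [C_mul_monomial, mul_one]
  rw [h2, map_mul, h1, aeval_C, algebraMap_eq, C_mul_monomial, mul_one]

theorem mem_segreIdeal_iff (f : MvPolynomial (Fin n × Fin n) K) :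
    f ∈ segreIdeal K n ↔ ∑ m ∈ f.support, monomial (segreExp m) (f.coeff m) = 0 := by
  rw [segreIdeal, RingHom.mem_ker]
  conv_lhs => rw [f.as_sum]
  simp only [map_sum, aeval_monomial_segre]

theorem span_twoMinors_le : Ideal.span (twoMinors K n) ≤ segreIdeal K n := by
  rw [Ideal.span_le]
  rintro _ ⟨i, h, j, k, -, -, rfl⟩
  change aeval _ _ = _
  simp only [map_sub, map_mul, aeval_X]
  ring

theorem minor_mem_span (p q : Fin n × Fin n) :
    (X p * X q - X (p.1, q.2) * X (q.1, p.2) : MvPolynomial (Fin n × Fin n) K) ∈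
      Ideal.span (twoMinors K n) := by
  obtain ⟨i, j⟩ := p
  obtain ⟨h, k⟩ := q
  dsimp only
  rcases lt_trichotomy i h with h1 | rfl | h1
  · rcases lt_trichotomy j k with h2 | rfl | h2
    · exact Ideal.subset_span ⟨i, h, j, k, h1, h2, rfl⟩
    · simp
    · rw [← neg_mem_iff, neg_sub]
      exact Ideal.subset_span ⟨i, h, k, j, h1, h2, rfl⟩
  · simp [mul_comm]
  · rcases lt_trichotomy j k with h2 | rfl | h2
    · rw [← neg_mem_iff, neg_sub, mul_comm (X (i, k)), mul_comm (X (i, j))]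
      exact Ideal.subset_span ⟨h, i, j, k, h1, h2, rfl⟩
    · simp
    · rw [mul_comm (X (i, k)), mul_comm (X (i, j))]
      exact Ideal.subset_span ⟨h, i, k, j, h1, h2, rfl⟩

/-- The pairs of off-diagonal cells whose products generate `H(2,n)`. -/
def IsBadPair (p q : Fin n × Fin n) : Prop :=
  p.1 ≠ p.2 ∧ q.1 ≠ q.2 ∧ (p.1 = q.2 ∨ p.1 < q.1 ∧ p.2 < q.2)

theorem IsBadPair.ne {p q : Fin n × Fin n} (h : IsBadPair p q) : p ≠ q := by
  rintro rfl
  exact h.2.2.elim h.1 fun h => lt_irrefl _ h.1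

theorem notMem_faces_iff {F : Finset (Fin n × Fin n)} :
    F ∉ (segreComplex n).faces ↔ ∃ p q, IsBadPair p q ∧ p ∈ F ∧ q ∈ F := by
  rw [segreComplex.mem_faces]
  constructor
  · intro h
    push Not at h
    obtain ⟨p, hp, q, hq, h1, h2, h3⟩ := h
    refine ⟨p, q, ⟨h1, h2, ?_⟩, hp, hq⟩
    by_cases h4 : p.1 = q.2
    · exact Or.inl h4
    · exact Or.inr (h3 h4)
  · rintro ⟨p, q, ⟨h1, h2, h3⟩, hp, hq⟩ h
    obtain ⟨h4, h5⟩ := h p hp q hq h1 h2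
    exact h3.elim h4 fun h3 => absurd (h5 h3.1) (not_le.2 h3.2)

theorem idealH_eq : idealH K n = Ideal.span ((fun e => monomial e (1 : K)) ''
    {e | ∃ p q : Fin n × Fin n, IsBadPair p q ∧
      e = Finsupp.single p 1 + Finsupp.single q 1}) := by
  have hX : ∀ p q : Fin n × Fin n, (X p * X q : MvPolynomial (Fin n × Fin n) K) =
      monomial (Finsupp.single p 1 + Finsupp.single q 1) 1 := by
    intro p q
    rw [X, X, monomial_mul, mul_one]
  rw [idealH]
  congr 1
  ext f
  constructor
  · rintro (⟨i, h, j, k, h1, h2, h3, rfl⟩ | ⟨i, h, j, k, h1, h2, h3, h4, rfl⟩)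
    · rcases h3 with h3 | h3
      · exact ⟨_, ⟨(i, k), (h, j), ⟨h1, h2, Or.inl h3⟩, rfl⟩, (hX _ _).symm⟩
      · refine ⟨_, ⟨(h, j), (i, k), ⟨h2, h1, Or.inl h3⟩, rfl⟩, ?_⟩
        rw [mul_comm]
        exact (hX _ _).symm
    · exact ⟨_, ⟨(i, j), (h, k), ⟨h1, h2, Or.inr ⟨h3, h4⟩⟩, rfl⟩, (hX _ _).symm⟩
  · rintro ⟨_, ⟨⟨i, k⟩, ⟨h, j⟩, ⟨h1, h2, h3⟩, rfl⟩, rfl⟩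
    dsimp only at h1 h2 h3 ⊢
    rw [← hX]
    rcases h3 with h3 | ⟨h3, h4⟩
    · exact Or.inl ⟨i, h, j, k, h1, h2, Or.inl h3, rfl⟩
    · exact Or.inr ⟨i, h, k, j, h1, h2, h3, h4, rfl⟩

theorem isNonFaceIdeal_idealH : IsNonFaceIdeal (segreComplex n) (idealH K n) := by
  intro f
  rw [idealH_eq, mem_ideal_span_monomial_image]
  refine forall₂_congr fun m _ => ?_
  rw [notMem_faces_iff]
  constructor
  · rintro ⟨_, ⟨p, q, h, rfl⟩, hle⟩
    exact ⟨p, q, h, (pair_le_iff h.ne m).1 hle⟩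
  · rintro ⟨p, q, h, hm⟩
    exact ⟨_, ⟨p, q, h, rfl⟩, (pair_le_iff h.ne m).2 hm⟩

variable {ord : LinearOrder (Fin n × Fin n)}

/-- If the exchanged pair contains a diagonal cell, that variable is smaller than both. Otherwise `i
- j` and `h - k` lie strictly between `i - k` and `h - j`, so one of the latter has the strictly
largest absolute value. -/
theorem IsBadPair.ord_lt (hord : IsDiagonalOrder ord) {p q : Fin n × Fin n}
    (hpq : IsBadPair p q) :
    (ord.lt (p.1, q.2) p ∧ ord.lt (p.1, q.2) q) ∨
      (ord.lt (q.1, p.2) p ∧ ord.lt (q.1, p.2) q) := by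
  obtain ⟨i, j⟩ := p
  obtain ⟨h, k⟩ := q
  obtain ⟨h1, h2, h3⟩ := hpq
  dsimp only at h1 h2 h3 ⊢
  by_cases hik : i = k
  · subst hik
    exact Or.inl ⟨hord.diag_lt_offDiag _ _ _ h1, hord.diag_lt_offDiag _ _ _ h2⟩
  by_cases hhj : h = j
  · subst hhj
    exact Or.inr ⟨hord.diag_lt_offDiag _ _ _ h1, hord.diag_lt_offDiag _ _ _ h2⟩
  obtain ⟨h3, h4⟩ := h3.resolve_left hik
  have h3' : (i : ℤ) < h := by exact_mod_cast h3
  have h4' : (j : ℤ) < k := by exact_mod_cast h4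
  rcases le_total |(h : ℤ) - j| |(i : ℤ) - k| with hle | hle
  · refine Or.inl ⟨hord.offDiag_lt_offDiag _ _ _ _ h1 hik ?_,
      hord.offDiag_lt_offDiag _ _ _ _ h2 hik ?_⟩ <;> grind
  · refine Or.inr ⟨hord.offDiag_lt_offDiag _ _ _ _ h1 hhj ?_,
      hord.offDiag_lt_offDiag _ _ _ _ h2 hhj ?_⟩ <;> grind

open scoped MonomialOrder

variable (K) in
/-- One step of the reduction modulo the `2`-minors. -/
theorem exists_reduction (hord : IsDiagonalOrder ord) {m : Fin n × Fin n →₀ ℕ}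
    (hm : m.support ∉ (segreComplex n).faces) :
    ∃ m', segreExp m' = segreExp m ∧ m' ≺[revLexOrder ord] m ∧
      (monomial m (1 : K) - monomial m' 1) ∈ Ideal.span (twoMinors K n) := by
  obtain ⟨p, q, hpq, hmem⟩ := notMem_faces_iff.1 hm
  obtain ⟨u, rfl⟩ := exists_add_of_le ((pair_le_iff hpq.ne m).2 hmem)
  refine ⟨Finsupp.single (p.1, q.2) 1 + Finsupp.single (q.1, p.2) 1 + u, ?_, ?_, ?_⟩
  · simp only [map_add, segreExp_single]
    abel
  · rw [map_add, map_add _ _ u]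
    exact add_lt_add_left (revLexOrder_pair_lt ord (hpq.ord_lt hord)) _
  · have h : ∀ a b : Fin n × Fin n, monomial (Finsupp.single a 1 + Finsupp.single b 1 + u) (1 : K) =
        monomial u 1 * (X a * X b) := by
      intro a b
      rw [X, X, monomial_mul, monomial_mul, mul_one, mul_one, add_comm]
    rw [h, h, ← mul_sub]
    exact Ideal.mul_mem_left _ _ (minor_mem_span p q)

variable (K) in
/-- Every monomial is congruent modulo the `2`-minors to a monomial supported on a face. -/
theorem exists_normalForm (hord : IsDiagonalOrder ord) (m : Fin n × Fin n →₀ ℕ) :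
    ∃ t : Fin n × Fin n →₀ ℕ, t.support ∈ (segreComplex n).faces ∧ segreExp t = segreExp m ∧
      t ≼[revLexOrder ord] m ∧
      (monomial m (1 : K) - monomial t 1) ∈ Ideal.span (twoMinors K n) := by
  induction m using (InvImage.wf (revLexOrder ord).toSyn wellFounded_lt).induction with
  | _ m ih =>
    by_cases hm : m.support ∈ (segreComplex n).faces
    · exact ⟨m, hm, rfl, le_refl _, by simp⟩
    · obtain ⟨m', h1, h2, h3⟩ := exists_reduction K hord hm
      obtain ⟨t, ht, h4, h5, h6⟩ := ih m' h2
      refine ⟨t, ht, h4.trans h1, h5.trans h2.le, ?_⟩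
      have := add_mem h3 h6
      rwa [sub_add_sub_cancel] at this

/-- Leading monomials of the Segre ideal are not supported on faces. -/
theorem support_degree_notMem_faces (hord : IsDiagonalOrder ord)
    {f : MvPolynomial (Fin n × Fin n) K} (hf : f ∈ segreIdeal K n) (hne : f ≠ 0) :
    ((revLexOrder ord).degree f).support ∉ (segreComplex n).faces := by
  intro ht
  set t := (revLexOrder ord).degree f with ht_def
  have h := congrArg (coeff (segreExp t)) ((mem_segreIdeal_iff f).1 hf)
  rw [coeff_sum, coeff_zero, Finset.sum_eq_single t] at h
  · rw [coeff_monomial, if_pos rfl] at h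
    exact (revLexOrder ord).coeff_degree_ne_zero_iff.2 hne h
  · intro m hm hmt
    rw [coeff_monomial, if_neg]
    intro h
    -- If `m` has the same image as `t`, its normal form is `t`, so `t ≼ m`; as `t` is the leading
    -- exponent this forces `m = t`. Nothing can cancel the leading coefficient in the image.
    obtain ⟨s, hs, hsm, hle, -⟩ := exists_normalForm K hord m
    obtain rfl := eq_of_segreExp_eq s t hs ht (hsm.trans h)
    refine hmt ((revLexOrder ord).toSyn.injective (le_antisymm ?_ hle))
    exact (revLexOrder ord).le_degree hm
  · intro h
    rw [coeff_monomial, if_pos rfl]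
    simpa using h

/-- Replacing each monomial of `f` by its normal form leaves an element of the toric ideal supported
on faces; its leading monomial would contradict `support_degree_notMem_faces` unless it is zero. -/
theorem segreIdeal_eq_span (hord : IsDiagonalOrder ord) :
    segreIdeal K n = Ideal.span (twoMinors K n) := by
  refine le_antisymm (fun f hf => ?_) span_twoMinors_le
  choose N hN _ _ hN' using exists_normalForm (ord := ord) K hord
  set g : MvPolynomial (Fin n × Fin n) K :=
    ∑ m ∈ f.support, monomial (N m) (f.coeff m) with hg
  have hfg : f - g ∈ Ideal.span (twoMinors K n) := by
    conv => arg 2; rw [f.as_sum]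
    rw [hg, ← Finset.sum_sub_distrib]
    refine sum_mem fun m _ => ?_
    have := Ideal.mul_mem_left _ (C (f.coeff m)) (hN' m)
    rwa [mul_sub, C_mul_monomial, C_mul_monomial, mul_one] at this
  have hgI : g ∈ segreIdeal K n := by
    have := sub_mem hf (span_twoMinors_le hfg)
    rwa [sub_sub_cancel] at this
  have hg0 : g = 0 := by
    by_contra hne
    have hcoeff := (revLexOrder ord).coeff_degree_ne_zero_iff.2 hne
    rw [hg, coeff_sum, ← hg] at hcoeff
    obtain ⟨m, -, hm⟩ := Finset.exists_ne_zero_of_sum_ne_zero hcoeff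
    rw [coeff_monomial] at hm
    have hm' : N m = (revLexOrder ord).degree g := by
      by_contra h
      exact hm (if_neg h)
    exact support_degree_notMem_faces hord hgI hne (hm' ▸ hN m)
  rwa [hg0, sub_zero] at hfg

theorem initialIdeal_segreIdeal (hord : IsDiagonalOrder ord) :
    initialIdeal (revLexOrder ord) (segreIdeal K n) = idealH K n := by
  classical
  apply le_antisymm
  · rw [initialIdeal, Ideal.span_le]
    rintro _ ⟨f, hf, rfl⟩
    rcases eq_or_ne f 0 with rfl | hne
    · simp
    · rw [SetLike.mem_coe, isNonFaceIdeal_idealH, MonomialOrder.leadingTerm]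
      intro m hm
      rw [Finset.mem_singleton.1 (support_monomial_subset hm)]
      exact support_degree_notMem_faces hord hf hne
  · rw [idealH_eq, Ideal.span_le]
    rintro _ ⟨e, ⟨p, q, hpq, rfl⟩, rfl⟩
    obtain ⟨m', -, hlt, hmem⟩ := exists_reduction K hord
      (m := Finsupp.single p 1 + Finsupp.single q 1)
      (notMem_faces_iff.2 ⟨p, q, hpq, (pair_le_iff hpq.ne _).1 le_rfl⟩)
    refine Ideal.subset_span ⟨_, span_twoMinors_le hmem, ?_⟩
    have hlt' : (revLexOrder ord).degree (monomial m' (1 : K)) ≺[revLexOrder ord]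
        (revLexOrder ord).degree
          (monomial (Finsupp.single p 1 + Finsupp.single q 1) (1 : K)) := by
      simpa [MonomialOrder.degree_monomial] using hlt
    rw [MonomialOrder.leadingTerm, MonomialOrder.degree_sub_of_lt hlt',
      MonomialOrder.leadingCoeff_sub_of_lt hlt', MonomialOrder.degree_monomial,
      if_neg one_ne_zero, MonomialOrder.leadingCoeff_monomial]

end Segre

/-! ### The Hilbert series -/

section Counting

variable {n : ℕ}

theorem sum_segreExp_inl (m : Fin n × Fin n →₀ ℕ) :
    ∑ i, segreExp m (Sum.inl i) = ∑ p, m p := by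
  classical
  induction m using Finsupp.induction_linear with
  | zero => simp
  | add a b ha hb => simp [Finset.sum_add_distrib, ha, hb]
  | single p k => simp [segreExp_single, Finsupp.single_apply]

theorem sum_segreExp_inr (m : Fin n × Fin n →₀ ℕ) :
    ∑ j, segreExp m (Sum.inr j) = ∑ p, m p := by
  classical
  induction m using Finsupp.induction_linear with
  | zero => simp
  | add a b ha hb => simp [Finset.sum_add_distrib, ha, hb]
  | single p k => simp [segreExp_single, Finsupp.single_apply]

theorem exists_segreExp_eq {d : ℕ} (e : Fin n ⊕ Fin n →₀ ℕ) (hl : ∑ i, e (Sum.inl i) = d)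
    (hr : ∑ j, e (Sum.inr j) = d) : ∃ m, segreExp m = e := by
  classical
  induction d generalizing e with
  | zero =>
    refine ⟨0, ?_⟩
    rw [map_zero]
    ext (i | j)
    · exact ((Finset.sum_eq_zero_iff.1 hl) i (Finset.mem_univ i)).symm
    · exact ((Finset.sum_eq_zero_iff.1 hr) j (Finset.mem_univ j)).symm
  | succ d ih =>
    -- Any `r_i` and any `s_j` that occur can be paired off as the image of `x_ij`.
    obtain ⟨i, -, hi⟩ := Finset.exists_ne_zero_of_sum_ne_zero (hl.trans_ne d.succ_ne_zero)
    obtain ⟨j, -, hj⟩ := Finset.exists_ne_zero_of_sum_ne_zero (hr.trans_ne d.succ_ne_zero)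
    have hle : Finsupp.single (Sum.inl i) 1 + Finsupp.single (Sum.inr j) 1 ≤ e :=
      (pair_le_iff Sum.inl_ne_inr e).2 ⟨Finsupp.mem_support_iff.2 hi, Finsupp.mem_support_iff.2 hj⟩
    obtain ⟨u, rfl⟩ := exists_add_of_le hle
    simp only [Finsupp.add_apply, Finset.sum_add_distrib, Finsupp.single_apply, Sum.inl.injEq,
      Sum.inr.injEq, reduceCtorEq, Finset.sum_ite_eq, Finset.mem_univ, if_true, if_false,
      Finset.sum_const_zero] at hl hr
    obtain ⟨m, rfl⟩ := ih u (by omega) (by omega)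
    exact ⟨Finsupp.single (i, j) 1 + m, by rw [map_add, segreExp_single]⟩

theorem card_finsuppAntidiag_univ (m d : ℕ) :
    (Finset.finsuppAntidiag (Finset.univ : Finset (Fin (m + 1))) d).card = (m + d).choose m := by
  have h := congrArg (PowerSeries.coeff d) (PowerSeries.mk_one_pow_eq_mk_choose_add ℤ m)
  have hprod : (PowerSeries.mk 1 : PowerSeries ℤ) ^ (m + 1) =
      ∏ _i : Fin (m + 1), PowerSeries.mk 1 := by simp
  rw [hprod, PowerSeries.coeff_prod] at h
  simpa using h

open scoped Classical in
/-- The monomials of degree `d` that do not lie in `H(2,n)` correspond to pairs of monomials of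
degree `d` in `n` variables. -/
theorem card_filter_mem_faces {ord : LinearOrder (Fin n × Fin n)} (hord : IsDiagonalOrder ord)
    (d : ℕ) :
    ((Finset.finsuppAntidiag (Finset.univ : Finset (Fin n × Fin n)) d).filter
      (fun m => m.support ∈ (segreComplex n).faces)).card =
      (Finset.finsuppAntidiag (Finset.univ : Finset (Fin n)) d).card ^ 2 := by
  rw [sq, ← Finset.card_product]
  refine Finset.card_bij (fun m _ => Finsupp.sumFinsuppEquivProdFinsupp (segreExp m)) ?_ ?_ ?_
  · intro m hm
    rw [Finset.mem_filter, Finset.mem_finsuppAntidiag] at hm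
    rw [Finset.mem_product, Finset.mem_finsuppAntidiag, Finset.mem_finsuppAntidiag]
    refine ⟨⟨?_, Finset.subset_univ _⟩, ?_, Finset.subset_univ _⟩
    · exact (sum_segreExp_inl m).trans hm.1.1
    · exact (sum_segreExp_inr m).trans hm.1.1
  · intro m hm m' hm' h
    exact segreComplex.eq_of_segreExp_eq m m' (Finset.mem_filter.1 hm).2
      (Finset.mem_filter.1 hm').2 (Finsupp.sumFinsuppEquivProdFinsupp.injective h)
  · intro b hb
    obtain ⟨e, rfl⟩ := Finsupp.sumFinsuppEquivProdFinsupp.surjective b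
    rw [Finset.mem_product, Finset.mem_finsuppAntidiag, Finset.mem_finsuppAntidiag] at hb
    obtain ⟨m, rfl⟩ := exists_segreExp_eq (d := d) e hb.1.1 hb.2.1
    -- Only exponent vectors matter here, so the choice of field is immaterial.
    obtain ⟨t, ht, htm, -, -⟩ := exists_normalForm ℚ hord m
    refine ⟨t, Finset.mem_filter.2 ⟨Finset.mem_finsuppAntidiag.2 ⟨?_, Finset.subset_univ _⟩, ht⟩,
      by rw [htm]⟩
    rw [← sum_segreExp_inl, htm]
    exact hb.1.1

theorem hilbertFn_idealH (K : Type*) [Field K] {m : ℕ}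
    {ord : LinearOrder (Fin (m + 1) × Fin (m + 1))} (hord : IsDiagonalOrder ord) (d : ℕ) :
    hilbertFn (idealH K (m + 1)) d = (m + d).choose m ^ 2 := by
  classical
  rw [isNonFaceIdeal_idealH.hilbertFn_eq, ← card_finsuppAntidiag_univ,
    ← card_filter_mem_faces hord]
  congr!

/-- Vandermonde applied to one factor, then regrouping. With `x = m + d`, each `x.choose (m + k)`
has generating function `X ^ k / (1 - X) ^ (m + k + 1)`. -/
theorem choose_sq_eq_sum (x m : ℕ) :
    x.choose m ^ 2 =
      ∑ k ∈ Finset.range (m + 1), (m + k).choose m * m.choose k * x.choose (m + k) := by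
  rcases lt_or_ge x m with hx | hx
  · rw [Nat.choose_eq_zero_of_lt hx, Finset.sum_eq_zero]
    · simp
    · intro k _
      rw [Nat.choose_eq_zero_of_lt (show x < m + k by omega), mul_zero]
  obtain ⟨y, rfl⟩ := Nat.exists_eq_add_of_le hx
  have hv : (m + y).choose m = ∑ k ∈ Finset.range (m + 1), m.choose k * y.choose k := by
    rw [Nat.add_choose_eq, ← Finset.sum_flip,
      Finset.Nat.sum_antidiagonal_eq_sum_range_succ fun i j => m.choose i * y.choose j]
    refine Finset.sum_congr rfl fun k hk => ?_
    have hk : k ≤ m := Nat.lt_succ_iff.1 (Finset.mem_range.1 hk)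
    rw [Nat.choose_symm hk]
  rw [sq]
  nth_rw 2 [hv]
  rw [Finset.mul_sum]
  refine Finset.sum_congr rfl fun k _ => ?_
  have h := Nat.choose_mul (n := m + y) (k := m + k) (s := m) (Nat.le_add_right m k)
  rw [Nat.add_sub_cancel_left, Nat.add_sub_cancel_left] at h
  calc _ = m.choose k * ((m + y).choose m * y.choose k) := by ring
    _ = _ := by rw [← h]; ring

theorem mk_choose_mul {m k : ℕ} (hk : k ≤ m) :
    PowerSeries.mk (fun d => ((m + d).choose (m + k) : ℤ)) * (1 - PowerSeries.X) ^ (2 * m + 1) =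
      PowerSeries.X ^ k * (1 - PowerSeries.X) ^ (m - k) := by
  have h : PowerSeries.mk (fun d => ((m + d).choose (m + k) : ℤ)) =
      PowerSeries.X ^ k * (PowerSeries.mk 1) ^ (m + k + 1) := by
    rw [PowerSeries.mk_one_pow_eq_mk_choose_add]
    ext d
    rw [PowerSeries.coeff_X_pow_mul', PowerSeries.coeff_mk, PowerSeries.coeff_mk]
    split_ifs with hd
    · rw [show m + k + (d - k) = m + d by omega]
    · rw [Nat.choose_eq_zero_of_lt (by omega), Nat.cast_zero]
  rw [h, show 2 * m + 1 = (m + k + 1) + (m - k) by omega, pow_add _ (m + k + 1) (m - k),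
    ← mul_assoc, mul_assoc (PowerSeries.X ^ k), ← mul_pow, PowerSeries.mk_one_mul_one_sub_eq_one,
    one_pow, mul_one]

/-- The numerator of the Hilbert series of the Segre variety `ℙᵐ × ℙᵐ`. -/
noncomputable def segreNumerator (m : ℕ) : Polynomial ℤ :=
  ∑ k ∈ Finset.range (m + 1), Polynomial.C (((m + k).choose m * m.choose k : ℕ) : ℤ) *
    (Polynomial.X ^ k * (1 - Polynomial.X) ^ (m - k))

theorem segreNumerator_eval_one (m : ℕ) :
    (segreNumerator m).eval 1 = ((2 * m).choose m : ℤ) := by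
  rw [segreNumerator, Polynomial.eval_finsetSum, Finset.sum_eq_single m]
  · simp [two_mul]
  · intro k hk hkm
    have : m - k ≠ 0 := by
      have := Finset.mem_range.1 hk
      omega
    simp [this]
  · simp

theorem mk_hilbertFn_idealH_mul (K : Type*) [Field K] {m : ℕ}
    {ord : LinearOrder (Fin (m + 1) × Fin (m + 1))} (hord : IsDiagonalOrder ord) :
    PowerSeries.mk (fun d => (hilbertFn (idealH K (m + 1)) d : ℤ)) *
      (1 - PowerSeries.X) ^ (2 * m + 1) = (segreNumerator m : PowerSeries ℤ) := by
  have h : PowerSeries.mk (fun d => (hilbertFn (idealH K (m + 1)) d : ℤ)) =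
      ∑ k ∈ Finset.range (m + 1), PowerSeries.C (((m + k).choose m * m.choose k : ℕ) : ℤ) *
        PowerSeries.mk (fun d => ((m + d).choose (m + k) : ℤ)) := by
    ext d
    rw [PowerSeries.coeff_mk, hilbertFn_idealH K hord, choose_sq_eq_sum, map_sum, Nat.cast_sum]
    refine Finset.sum_congr rfl fun k _ => ?_
    rw [PowerSeries.coeff_C_mul, PowerSeries.coeff_mk]
    push_cast
    ring
  rw [h, Finset.sum_mul, segreNumerator, ← Polynomial.coeToPowerSeries.ringHom_apply, map_sum]
  refine Finset.sum_congr rfl fun k hk => ?_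
  rw [mul_assoc, mk_choose_mul (Nat.lt_succ_iff.1 (Finset.mem_range.1 hk))]
  simp only [map_mul, map_pow, map_sub, map_one, Polynomial.coeToPowerSeries.ringHom_apply,
    Polynomial.coe_X, Polynomial.coe_C]

end Counting

/-! ### Assembly of the main theorem -/

theorem mainTheorem4 (K : Type*) [Field K] (n : ℕ) (hn : 1 ≤ n)
    (ord : LinearOrder (Fin n × Fin n)) (hord : IsDiagonalOrder ord) :
    segreIdeal K n = Ideal.span (twoMinors K n) ∧
    initialIdeal (revLexOrder ord) (segreIdeal K n) = idealH K n ∧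
    IsPureIdeal (idealH K n) (2 * n - 1) ∧
    HasDegree (idealH K n) ((2 * n - 2).choose (n - 1)) ∧
    (complexOf (idealH K n)).core.IsPure ∧
    (∀ F ∈ (complexOf (idealH K n)).core.facets, faceDim F = (n : ℤ) - 2) ∧
    (complexOf (idealH K n)).core.facets.ncard = (2 * n - 2).choose (n - 1) ∧
    (complexOf (idealH K n)).conePoints = Set.range (fun i : Fin n => (i, i)) ∧
    (complexOf (idealH K n)).conePoints.ncard = n := by
  classical
  have hI : IsNonFaceIdeal (segreComplex n) (idealH K n) := isNonFaceIdeal_idealH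
  have hfacets := segreComplex.facets_eq hn
  have hcore := segreComplex.core_facets_eq hn
  have hpure : IsPureIdeal (idealH K n) (2 * n - 1) := by
    refine hI.isPureIdeal ?_ fun F hF => ?_
    · obtain ⟨F, hF, -⟩ := (segreComplex n).exists_facet_superset (F := ∅)
        (fun p hp => absurd hp (Finset.notMem_empty p))
      exact ⟨F, hF⟩
    · rw [hfacets] at hF
      exact hF.2
  rw [hI.complexOf_eq]
  refine ⟨segreIdeal_eq_span hord, initialIdeal_segreIdeal hord, hpure, ?_, ?_, ?_, ?_,
    segreComplex.conePoints_eq, ?_⟩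
  · refine ⟨2 * n - 1, segreNumerator (n - 1), hpure.1, ?_, ?_⟩
    · obtain ⟨m, rfl⟩ := Nat.exists_eq_add_of_le' hn
      exact mk_hilbertFn_idealH_mul K hord
    · rw [segreNumerator_eval_one, Nat.mul_sub]
  · intro F hF G hG
    rw [hcore] at hF hG
    rw [hF.2, hG.2]
  · intro F hF
    rw [hcore] at hF
    rw [faceDim, hF.2]
    omega
  -- Facets are the faces of size `2 * n - 1`, and their number is the numerator of the Hilbert
  -- series evaluated at 1.
  · rw [segreComplex.ncard_core_facets hn, hfacets]
    obtain ⟨m, rfl⟩ := Nat.exists_eq_add_of_le' hn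
    have h := hI.eval_one_eq_card (D := 2 * m + 1) (fun F hF => segreComplex.card_le hF hn)
      (mk_hilbertFn_idealH_mul K hord)
    rw [segreNumerator_eval_one, Nat.cast_inj] at h
    rw [show 2 * (m + 1) - 2 = 2 * m by omega, Nat.add_sub_cancel, h, ← Set.ncard_coe_finset]
    congr 1
    ext F
    simp [show 2 * (m + 1) - 1 = 2 * m + 1 by omega]
  · rw [segreComplex.conePoints_eq, ← Set.image_univ, Set.ncard_image_of_injective _
      fun i j h => (Prod.ext_iff.1 h).1]
    simp
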